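/- All vector spaces are real and $\mathbb{R}^+=[0,\infty)$. A *weaknorm* on a vector space $X$ is a map $p:X\to\mathbb{R}^+$ with $p(0)=0$, $p(-x)=p(x)$ for all $x\in X$, and $p(\alpha x_1+(1-\alpha)x_2)\le \alpha p(x_1)+(1-\alpha)p(x_2)$ for all $x_1,x_2\in X$ and $0\le\alpha\le 1$. A map $q:X\to\mathbb{R}^+$ is a *quasi-weaknorm* with *adjoint weaknorm* $p$ and *associated weighted function* $\varphi$ if $p$ is a weaknorm on $X$, $\varphi:\mathbb{R}^+\to\mathbb{R}^+$ is strictly increasing and continuous with $\varphi(0)=0$, and $q(x)\le\varphi(p(x))$ for all $x\in X$. A topological vector space $(X,\tau)$ is *quasi-locally convex* with respect to a family $\{q_\lambda\}_{\lambda\in\Lambda}$ of maps $X\to\mathbb{R}^+$ if each $q_\lambda$ is a $\tau$-continuous quasi-weaknorm that has a $\tau$-continuous adjoint weaknorm $p_\lambda$ and an associated weighted function $\varphi_\lambda$, and $\tau$ is the initial topology induced by the family, i.e. the coarsest topology on $X$ for which all the maps $x\mapsto q_\lambda(x-y)$, with $\lambda\in\Lambda$ and $y\in X$, are continuous. The family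 is *total* if $x=0$ whenever $q_\lambda(x)=0$ for every $\lambda\in\Lambda$. **Theorem 4.1.** Let $(X,\tau)$ be a Hausdorff topological vector space that is quasi-locally convex with respect to a total family $\{q_\lambda\}_{\lambda\in\Lambda}$ of quasi-weaknorms. Let $C$ be a nonempty compact convex subset of $X$. Then every continuous mapping $f:C\to C$ has a fixed point. -/

import Mathlib

open scoped NNReal

/-- A weaknorm on a real vector space: a map `p : X → [0, ∞)` which vanishes at the origin,
is even, and is convex. -/
structure IsWeaknorm {X : Type*} [AddCommGroup X] [Module ℝ X] (p : X → ℝ≥0) : Prop where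
  map_zero : p 0 = 0
  map_neg : ∀ x, p (-x) = p x
  convexOn : ConvexOn ℝ Set.univ (fun x => (p x : ℝ))

/-- `q` is a quasi-weaknorm, with `p` as an adjoint weaknorm and `φ` as an associated weighted
function: the map `p` is a weaknorm, `φ : [0, ∞) → [0, ∞)` is strictly increasing and continuous
with `φ 0 = 0`, and `q x ≤ φ (p x)` for all `x`. -/
structure IsQuasiWeaknormWith {X : Type*} [AddCommGroup X] [Module ℝ X]
    (q p : X → ℝ≥0) (φ : ℝ≥0 → ℝ≥0) : Prop where
  weaknorm : IsWeaknorm p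
  strictMono : StrictMono φ
  continuous : Continuous φ
  map_zero : φ 0 = 0
  le : ∀ x, q x ≤ φ (p x)

/-- The family `q` makes the topological vector space `X` quasi-locally convex: every `q i` is a
continuous quasi-weaknorm with a continuous adjoint weaknorm, and the topology of `X` is the
initial one, that is, the coarsest topology for which all the maps `x ↦ q i (x - y)` are
continuous. -/
structure IsQuasiLocallyConvexFamily {X : Type*} [AddCommGroup X] [Module ℝ X]
    [τ : TopologicalSpace X] {ι : Type*} (q : ι → X → ℝ≥0) : Prop where
  continuous : ∀ i, Continuous (q i)
  adjoint : ∀ i, ∃ (p : X → ℝ≥0) (φ : ℝ≥0 → ℝ≥0), Continuous p ∧ IsQuasiWeaknormWith (q i) p φ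
  initial : τ = ⨅ (i : ι) (y : X), TopologicalSpace.induced (fun x => q i (x - y)) inferInstance

/-- A family of maps is total if the origin is the only point at which all of them vanish. -/
def IsTotalFamily {X : Type*} [AddCommGroup X] {ι : Type*} (q : ι → X → ℝ≥0) : Prop :=
  ∀ x, (∀ i, q i x = 0) → x = 0

/-!
The topology plays only a small part: each `q i` is dominated by `φ i ∘ p i` with `φ i 0 = 0`, so
totality of `q` says that the continuous convex functions `p i` vanish simultaneously only at `0`.
A point `x` of `C` with `p i (f x - x) = 0` for all `i` is therefore a fixed point. By compactness
it is enough to treat finitely many `p i`, hence (taking their sum) a single `p`, and to find `x`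
with `p (f x - x) ≤ ε` for each `ε > 0`. This is Schauder's projection argument
(`exists_convexOn_le_of_continuousOn`), which needs nothing of `p` beyond continuity, convexity and
`p 0 = 0`: a partition of unity subordinate to finitely many sets `{z | p (z - y) < ε}` covering
`C` turns `f` into a self-map of a finite-dimensional simplex, and a fixed point of that map
gives `x`.

The finite-dimensional input is Brouwer's theorem. It is deduced from the absence of a `C¹`
retraction of the closed ball onto the sphere (`not_contDiff_retraction_sphere`), following Milnor
and Rogers. If `F` were such a retraction, then for small `t ≥ 0` the map `x ↦ x + t (F x - x)`
would be a bijection of the open ball with positive Jacobian, so that the integral of its Jacobian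
would be the volume of the ball. This integral is a polynomial in `t`, hence constant, but it
vanishes at `t = 1` because `‖F x‖ = 1` forces `fderiv ℝ F x` to be singular.
-/

/-! ### Jacobian determinants -/

/-- The range of the derivative is orthogonal to `F x`. -/
theorem det_eq_zero_of_norm_eq_one {E : Type*} [NormedAddCommGroup E] [InnerProductSpace ℝ E]
    [FiniteDimensional ℝ E] {F : E → E} {x : E} (hF : DifferentiableAt ℝ F x)
    (hnorm : ∀ᶠ y in nhds x, ‖F y‖ = 1) : (fderiv ℝ F x).det = 0 := by
  have horth : ∀ v, inner ℝ (F x) (fderiv ℝ F x v) = 0 := fun v => by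
    have h1 : (fun y => inner ℝ (F y) (F y)) =ᶠ[nhds x] fun _ => (1 : ℝ) := by
      filter_upwards [hnorm] with y hy
      rw [real_inner_self_eq_norm_sq, hy, one_pow]
    have h2 := fderiv_inner_apply ℝ hF hF v
    rw [h1.fderiv_eq, real_inner_comm] at h2
    simp at h2
    rw [real_inner_comm] at h2
    linarith
  by_contra hdet
  have hsurj : Function.Surjective (fderiv ℝ F x) :=
    ((fderiv ℝ F x : E →ₗ[ℝ] E).equivOfDetNeZero hdet).surjective
  obtain ⟨v, hv⟩ := hsurj (F x)
  have h := horth v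
  rw [hv, real_inner_self_eq_norm_sq, hnorm.self_of_nhds] at h
  norm_num at h

theorem exists_polynomial_eval_eq_det_one_add_smul {E : Type*} [NormedAddCommGroup E]
    [NormedSpace ℝ E] [FiniteDimensional ℝ E] (A : E →L[ℝ] E) :
    ∃ P : Polynomial ℝ, P.natDegree ≤ Module.finrank ℝ E ∧
      ∀ t : ℝ, P.eval t = (1 + t • A : E →L[ℝ] E).det := by
  let b := Module.finBasis ℝ E
  let M := LinearMap.toMatrix b b (A : E →ₗ[ℝ] E)
  refine ⟨Matrix.det ((Polynomial.X : Polynomial ℝ) • M.map Polynomial.C +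
    (1 : Matrix _ _ ℝ).map Polynomial.C), ?_, fun t => ?_⟩
  · simpa using Polynomial.natDegree_det_X_add_C_le M 1
  · have h1 : (1 + t • A : E →L[ℝ] E).det
        = LinearMap.det ((1 + t • A : E →L[ℝ] E) : E →ₗ[ℝ] E) := rfl
    rw [h1, ← LinearMap.det_toMatrix b, ← Polynomial.coe_evalRingHom, RingHom.map_det]
    congr 1
    ext i j
    simp [M, LinearMap.toMatrix_apply, Matrix.one_apply, b.repr_self, Finsupp.single_apply]
    split_ifs <;> simp_all <;> ring

/-! ### Bijections of the ball close to the identity -/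

open Set Metric in
/-- A segment from the ball to its complement crosses the sphere, where `g` vanishes. -/
theorem LipschitzOnWith.lipschitzWith_indicator_ball {E F : Type*} [NormedAddCommGroup E]
    [NormedSpace ℝ E] [NormedAddCommGroup F] {g : E → F} {K : ℝ≥0}
    (hg : LipschitzOnWith K g (closedBall 0 1)) (h0 : ∀ x, ‖x‖ = 1 → g x = 0) :
    LipschitzWith K ((ball 0 1).indicator g) := by
  have key : ∀ x ∈ ball (0 : E) 1, ∀ y ∉ ball (0 : E) 1, dist (g x) 0 ≤ K * dist x y := by
    intro x hx y hy
    obtain ⟨z, hz, hz1⟩ : ∃ z ∈ segment ℝ x y, ‖z‖ = 1 := by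
      have := (convex_segment (𝕜 := ℝ) x y).isPreconnected.intermediate_value
        (left_mem_segment ℝ x y) (right_mem_segment ℝ x y) continuous_norm.continuousOn
      obtain ⟨z, hz, h⟩ := this (show (1 : ℝ) ∈ Icc ‖x‖ ‖y‖ from
        ⟨by simpa using (mem_ball_zero_iff.1 hx).le, by simpa using hy⟩)
      exact ⟨z, hz, h⟩
    have hd : dist x z ≤ dist x y := by
      have := (convex_closedBall x (dist x y)).segment_subset
        (mem_closedBall_self dist_nonneg) (by simp [dist_comm]) hz
      simpa [dist_comm] using this
    calc dist (g x) 0 = dist (g x) (g z) := by rw [h0 z hz1]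
      _ ≤ K * dist x z := hg.dist_le_mul x (ball_subset_closedBall hx) z (by simp [hz1])
      _ ≤ K * dist x y := by gcongr
  refine LipschitzWith.of_dist_le_mul fun x y => ?_
  by_cases hx : x ∈ ball (0 : E) 1 <;> by_cases hy : y ∈ ball (0 : E) 1
  · simpa [indicator_of_mem hx, indicator_of_mem hy] using
      hg.dist_le_mul x (ball_subset_closedBall hx) y (ball_subset_closedBall hy)
  · rw [indicator_of_mem hx, indicator_of_notMem hy]; exact key x hx y hy
  · rw [indicator_of_notMem hx, indicator_of_mem hy, dist_comm, dist_comm x]; exact key y hy x hx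
  · rw [indicator_of_notMem hx, indicator_of_notMem hy, dist_self]; positivity

theorem LipschitzWith.bijective_id_add_smul {E : Type*} [NormedAddCommGroup E] [NormedSpace ℝ E]
    [CompleteSpace E] {g : E → E} {K : ℝ≥0} (hg : LipschitzWith K g) {t : ℝ≥0} (ht : t * K < 1) :
    Function.Bijective fun x => x + t • g x := by
  have happ : ApproximatesLinearOn (fun x => x + t • g x)
      ((ContinuousLinearEquiv.refl ℝ E : E ≃L[ℝ] E) : E →L[ℝ] E) Set.univ (t * K) := by
    intro x _ y _
    have := hg.dist_le_mul x y
    rw [dist_eq_norm, dist_eq_norm] at this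
    have e : x + t • g x - (y + t • g y) - (x - y) = t • (g x - g y) := by
      rw [smul_sub]; abel
    simp only [ContinuousLinearEquiv.coe_coe, ContinuousLinearEquiv.refl_apply]
    rw [e, NNReal.smul_def, norm_smul, NNReal.coe_mul, mul_assoc, Real.norm_of_nonneg t.coe_nonneg]
    gcongr
  have hc : Subsingleton E ∨
      t * K < ‖((ContinuousLinearEquiv.refl ℝ E).symm : E →L[ℝ] E)‖₊⁻¹ := by
    rcases subsingleton_or_nontrivial E with h | h
    · exact Or.inl h
    · right
      simpa using ht
  exact ⟨Set.injOn_univ.1 (happ.injOn hc), happ.surjective hc⟩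

theorem Function.Bijective.image_eq_of_eqOn_compl {α : Type*} {f : α → α} {s : Set α}
    (hf : Function.Bijective f) (h : ∀ x ∉ s, f x = x) : f '' s = s := by
  ext y
  constructor
  · rintro ⟨x, hx, rfl⟩
    by_contra hy
    exact hy ((hf.1 (h _ hy)).symm ▸ hx)
  · intro hy
    obtain ⟨x, rfl⟩ := hf.2 y
    by_cases hx : x ∈ s
    · exact ⟨x, hx, rfl⟩
    · exact absurd (h x hx ▸ hy) hx

/-! ### There is no continuously differentiable retraction onto the sphere -/

open Metric Set MeasureTheory in
/-- There is no `C¹` retraction of the closed unit ball onto the unit sphere. -/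
theorem not_contDiff_retraction_sphere {E : Type*} [NormedAddCommGroup E] [InnerProductSpace ℝ E]
    [FiniteDimensional ℝ E] {F : E → E} {U : Set E} (hU : IsOpen U) (hBU : closedBall 0 1 ⊆ U)
    (hF : ContDiffOn ℝ 1 F U) (hid : ∀ x, ‖x‖ = 1 → F x = x) :
    ¬ ∀ x ∈ closedBall (0 : E) 1, ‖F x‖ = 1 := by
  intro hnorm
  borelize E
  set B : Set E := ball 0 1 with hB
  have hBmeas : MeasurableSet B := measurableSet_ball
  have hdiff : ∀ x ∈ U, DifferentiableAt ℝ F x := fun x hx =>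
    (hF.differentiableOn one_ne_zero).differentiableAt (hU.mem_nhds hx)
  let A : E → E →L[ℝ] E := fun x => fderiv ℝ F x - 1
  have hAcont : ContinuousOn A (closedBall 0 1) :=
    ((hF.continuousOn_fderiv_of_isOpen hU le_rfl).mono hBU).sub continuousOn_const
  obtain ⟨M, hM⟩ := (isCompact_closedBall (0 : E) 1).exists_bound_of_continuousOn hAcont
  lift M to ℝ≥0 using (norm_nonneg _).trans (hM 0 (by simp))
  have hderiv : ∀ x ∈ U, HasFDerivAt (fun y => F y - y) (A x) x := fun x hx =>
    (hdiff x hx).hasFDerivAt.sub (hasFDerivAt_id x)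
  have hlip : LipschitzOnWith M (fun y => F y - y) (closedBall 0 1) :=
    (convex_closedBall (0 : E) 1).lipschitzOnWith_of_nnnorm_hasFDerivWithin_le
      (fun x hx => (hderiv x (hBU hx)).hasFDerivWithinAt) fun x hx => hM x hx
  -- extended by zero, the displacement is globally Lipschitz, so no regularity of the perturbed
  -- identity is needed at the boundary of the ball
  have hlip' := hlip.lipschitzWith_indicator_ball fun x hx => by simp [hid x hx]
  set g : E → E := B.indicator fun y => F y - y with hg
  obtain ⟨δ, hδ, hdetpos⟩ : ∃ δ > 0, ∀ T : E →L[ℝ] E, dist T 1 < δ → 0 < T.det := by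
    have h1 : (1 : E →L[ℝ] E).det = 1 := LinearMap.det_id
    have := (ContinuousLinearMap.continuous_det (𝕜 := ℝ) (E := E)).continuousAt.eventually
      (lt_mem_nhds (show (0 : ℝ) < (1 : E →L[ℝ] E).det by rw [h1]; exact one_pos))
    obtain ⟨δ, hδ, h⟩ := Metric.eventually_nhds_iff.1 this
    exact ⟨δ, hδ, fun T hT => h hT⟩
  -- for small `t`, the map `x ↦ x + t (F x - x)` permutes the ball and has positive
  -- Jacobian, so the change of variables formula computes the integral of the Jacobian
  have hsmall : ∀ t : ℝ≥0, t * (M : ℝ) < 1 → t * (M : ℝ) < δ →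
      IntegrableOn (fun x => (1 + (t : ℝ) • A x).det) B ∧
        ∫ x in B, (1 + (t : ℝ) • A x).det = volume.real B := by
    intro t ht1 htδ
    have hbij := hlip'.bijective_id_add_smul (t := t) (by exact_mod_cast ht1)
    have himage := hbij.image_eq_of_eqOn_compl (s := B) fun x hx => by
      simp [g, indicator_of_notMem hx]
    have hd : ∀ x ∈ B, HasFDerivWithinAt (fun x => x + t • g x) (1 + (t : ℝ) • A x) B x := by
      intro x hx
      have h1 : HasFDerivAt (fun x => x + t • (F x - x)) (1 + (t : ℝ) • A x) x :=
        (hasFDerivAt_id x).add ((hderiv x (hBU (ball_subset_closedBall hx))).const_smul (t : ℝ))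
      refine h1.hasFDerivWithinAt.congr (fun y hy => ?_) ?_
      · simp [g, indicator_of_mem hy]
      · simp [g, indicator_of_mem hx]
    have hpos : ∀ x ∈ B, |(1 + (t : ℝ) • A x).det| = (1 + (t : ℝ) • A x).det := fun x hx => by
      refine abs_of_pos (hdetpos _ ?_)
      rw [dist_eq_norm, add_sub_cancel_left, norm_smul, Real.norm_of_nonneg t.coe_nonneg]
      refine lt_of_le_of_lt ?_ htδ
      gcongr
      exact hM x (ball_subset_closedBall hx)
    have hint := integrableOn_image_iff_integrableOn_abs_det_fderiv_smul volume hBmeas hd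
      hbij.1.injOn (fun _ => (1 : ℝ))
    have heq := integral_image_eq_integral_abs_det_fderiv_smul volume hBmeas hd
      hbij.1.injOn (fun _ => (1 : ℝ))
    rw [himage] at hint heq
    simp only [smul_eq_mul, mul_one] at hint heq
    constructor
    · refine (hint.1 ?_).congr_fun hpos hBmeas
      exact integrableOn_const measure_ball_lt_top.ne
    · rw [← setIntegral_congr_fun hBmeas hpos, ← heq]
      simp
  obtain ⟨τ, hτ, hτ1, hτδ⟩ : ∃ τ : ℝ≥0, 0 < τ ∧ τ * (M : ℝ) < 1 ∧ τ * (M : ℝ) < δ := by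
    have hm : 0 < min 1 δ := lt_min one_pos hδ
    have h : min 1 δ / (M + 1) * M < min 1 δ := by
      rw [div_mul_eq_mul_div, div_lt_iff₀ (by positivity)]
      nlinarith
    have hτ : 0 < min 1 δ / (M + 1) := by positivity
    lift min 1 δ / (M + 1 : ℝ) to ℝ≥0 using hτ.le with τ
    exact ⟨τ, by exact_mod_cast hτ, h.trans_le (min_le_left _ _), h.trans_le (min_le_right _ _)⟩
  -- interpolation nodes in `(0, τ]`
  let v : ℕ → ℝ≥0 := fun j => τ / (j + 1)
  have hvle : ∀ j, v j ≤ τ := fun j => div_le_self τ.2 (by simp)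
  have hvinj : Function.Injective fun j => (v j : ℝ) := fun i j hij => by
    have h : v i = v j := NNReal.coe_injective hij
    simp only [v] at h
    rw [div_eq_mul_inv, div_eq_mul_inv] at h
    have := inv_injective (mul_left_cancel₀ hτ.ne' h)
    exact_mod_cast add_right_cancel this
  set s := Finset.range (Module.finrank ℝ E + 1) with hs
  -- `c j` is the weight of the value at `v j` when a polynomial is extrapolated to `1`
  let c : ℕ → ℝ := fun j => (Lagrange.basis s (fun j => (v j : ℝ)) j).eval 1
  have hc : ∑ j ∈ s, c j = 1 := by
    have := Lagrange.sum_basis (s := s) hvinj.injOn (by simp [hs])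
    have h2 := congrArg (Polynomial.eval 1) this
    simpa [Polynomial.eval_finsetSum] using h2
  have hvs : ∀ j, IntegrableOn (fun x => (1 + (v j : ℝ) • A x).det) B ∧
        ∫ x in B, (1 + (v j : ℝ) • A x).det = volume.real B := fun j => by
    have : (v j : ℝ) * M ≤ τ * M := by gcongr; exact hvle j
    exact hsmall _ (this.trans_lt hτ1) (this.trans_lt hτδ)
  have hinterp : ∀ x ∈ B, ∑ j ∈ s, c j * (1 + (v j : ℝ) • A x).det = 0 := by
    intro x hx
    obtain ⟨P, hPdeg, hP⟩ := exists_polynomial_eval_eq_det_one_add_smul (A x)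
    have hdet : P.eval 1 = 0 := by
      rw [hP, one_smul, add_sub_cancel]
      refine det_eq_zero_of_norm_eq_one (hdiff x (hBU (ball_subset_closedBall hx))) ?_
      filter_upwards [isOpen_ball.mem_nhds hx] with y hy
      exact hnorm y (ball_subset_closedBall hy)
    have h := Lagrange.eq_interpolate (s := s) (f := P) hvinj.injOn
      (Polynomial.degree_le_natDegree.trans_lt (by
        rw [hs, Finset.card_range]; exact_mod_cast Nat.lt_succ_of_le hPdeg))
    rw [h, Lagrange.interpolate_apply, Polynomial.eval_finsetSum] at hdet
    rw [← hdet]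
    refine Finset.sum_congr rfl fun j _ => ?_
    rw [Polynomial.eval_mul, Polynomial.eval_C, hP, mul_comm]
  have hzero : ∫ x in B, ∑ j ∈ s, c j * (1 + (v j : ℝ) • A x).det = 0 := by
    rw [setIntegral_congr_fun hBmeas hinterp]; simp
  rw [integral_finsetSum _ fun j _ => (hvs j).1.const_mul (c j)] at hzero
  simp_rw [integral_const_mul, fun j => (hvs j).2] at hzero
  rw [← Finset.sum_mul, hc, one_mul] at hzero
  have hpos : 0 < volume.real B :=
    ENNReal.toReal_pos (measure_ball_pos volume (0 : E) one_pos).ne' measure_ball_lt_top.ne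
  exact hpos.ne' hzero

/-! ### Brouwer's theorem for the ball -/

open Metric in
/-- Sending `x` to the point where the ray from `h x` through `x` leaves the ball would otherwise be
a retraction onto the sphere. -/
theorem exists_fixedPoint_of_contDiff {E : Type*} [NormedAddCommGroup E]
    [InnerProductSpace ℝ E] [FiniteDimensional ℝ E] {h : E → E} (hh : ContDiff ℝ 1 h)
    (hball : ∀ x, ‖h x‖ ≤ 1) : ∃ x ∈ closedBall (0 : E) 1, h x = x := by
  by_contra! hne
  -- `‖x + s (x - h x)‖ = 1` reads `a s² + 2 b s + ‖x‖² - 1 = 0`; `F x` comes from the larger root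
  let a : E → ℝ := fun x => ‖x - h x‖ ^ 2
  let b : E → ℝ := fun x => inner ℝ x (x - h x)
  let D : E → ℝ := fun x => b x ^ 2 + a x * (1 - ‖x‖ ^ 2)
  let F : E → E := fun x => x + ((-b x + √(D x)) / a x) • (x - h x)
  have ha : ContDiff ℝ 1 a := (contDiff_id.sub hh).norm_sq ℝ
  have hb : ContDiff ℝ 1 b := ContDiff.inner ℝ contDiff_id (contDiff_id.sub hh)
  have hD : ContDiff ℝ 1 D :=
    (hb.pow 2).add (ha.mul (contDiff_const.sub (contDiff_id.norm_sq ℝ)))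
  have ha_pos : ∀ x ∈ closedBall (0 : E) 1, 0 < a x := fun x hx =>
    pow_pos (norm_pos_iff.2 (sub_ne_zero.2 (hne x hx).symm)) 2
  have hb_pos : ∀ x, ‖x‖ = 1 → 0 < b x := by
    intro x hx
    have h1 : a x = 2 * b x + ‖h x‖ ^ 2 - 1 := by
      simp only [a, b]
      rw [norm_sub_sq_real, inner_sub_right, real_inner_self_eq_norm_sq, hx]; ring
    have h2 := ha_pos x (by simp [hx])
    nlinarith [hball x, norm_nonneg (h x)]
  have hD_pos : ∀ x ∈ closedBall (0 : E) 1, 0 < D x := by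
    intro x hx
    have hx1 : ‖x‖ ≤ 1 := by simpa using hx
    rcases hx1.eq_or_lt with h1 | h1
    · have := hb_pos x h1
      simp only [D, h1]; nlinarith
    · have : 0 < a x * (1 - ‖x‖ ^ 2) :=
        mul_pos (ha_pos x hx) (by nlinarith [norm_nonneg x])
      simp only [D]; nlinarith [sq_nonneg (b x)]
  refine not_contDiff_retraction_sphere (F := F) (U := {x | 0 < a x} ∩ {x | 0 < D x})
    ((isOpen_lt continuous_const ha.continuous).inter (isOpen_lt continuous_const hD.continuous))
    (fun x hx => ⟨ha_pos x hx, hD_pos x hx⟩) ?_ ?_ ?_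
  · refine contDiffOn_id.add (ContDiffOn.smul (ContDiffOn.div ?_ ha.contDiffOn
      fun x hx => (show 0 < a x from hx.1).ne') (contDiff_id.sub hh).contDiffOn)
    exact hb.neg.contDiffOn.add (hD.contDiffOn.sqrt fun x hx => (show 0 < D x from hx.2).ne')
  · intro x hx
    have : √(D x) = b x := by
      simp only [D, hx]
      rw [one_pow, sub_self, mul_zero, add_zero, Real.sqrt_sq (hb_pos x hx).le]
    simp [F, this]
  · intro x hx
    have h1 := (ha_pos x hx).ne'
    have h2 := Real.sq_sqrt (hD_pos x hx).le
    have h3 : ‖F x‖ ^ 2 = 1 := by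
      simp only [F]
      rw [norm_add_sq_real, inner_smul_right, norm_smul, mul_pow, Real.norm_eq_abs, sq_abs]
      change ‖x‖ ^ 2 + 2 * ((-b x + √(D x)) / a x * b x) + ((-b x + √(D x)) / a x) ^ 2 * a x = 1
      field_simp
      have h4 : D x = b x ^ 2 + a x * (1 - ‖x‖ ^ 2) := rfl
      linear_combination h2 + h4
    exact (pow_eq_one_iff_of_nonneg (norm_nonneg _) two_ne_zero).1 h3

open Metric in
/-- **Brouwer's fixed point theorem**, for a continuous map of the whole space into the closed unit
ball. -/
theorem exists_fixedPoint_of_continuous {E : Type*} [NormedAddCommGroup E]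
    [InnerProductSpace ℝ E] [FiniteDimensional ℝ E] {h : E → E} (hh : Continuous h)
    (hball : ∀ x, ‖h x‖ ≤ 1) : ∃ x ∈ closedBall (0 : E) 1, h x = x := by
  by_contra! hne
  obtain ⟨x₀, hx₀, hmin⟩ := (isCompact_closedBall (0 : E) 1).exists_isMinOn
    ⟨0, by simp⟩ (hh.sub continuous_id).norm.continuousOn
  have hδ : 0 < ‖h x₀ - x₀‖ := norm_pos_iff.2 (sub_ne_zero.2 (hne x₀ hx₀))
  set ε := ‖h x₀ - x₀‖ / 3 with hε_def
  have hε : 0 < ε := by positivity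
  obtain ⟨g, hg, hgh, -⟩ := hh.exists_contDiff_approx (ε := fun _ => ε) 1 continuous_const
    fun _ => hε
  have hgnorm : ∀ x, ‖g x‖ ≤ 1 + ε := fun x => by
    have h1 := (hgh x).le
    rw [dist_eq_norm] at h1
    calc ‖g x‖ = ‖h x + (g x - h x)‖ := by rw [add_sub_cancel]
      _ ≤ 1 + ε := (norm_add_le _ _).trans (add_le_add (hball x) h1)
  -- rescaling the smooth approximation keeps its values in the unit ball
  obtain ⟨x, hx, hfix⟩ := exists_fixedPoint_of_contDiff
    (h := fun x => (1 + ε)⁻¹ • g x) (contDiff_const.smul hg) fun x => by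
      rw [norm_smul, Real.norm_of_nonneg (by positivity), inv_mul_le_one₀ (by positivity)]
      exact hgnorm x
  have hgx : g x = (1 + ε) • x := by
    conv_rhs => rw [← hfix, smul_inv_smul₀ (by positivity)]
  have h1 := hgh x
  rw [dist_comm, dist_eq_norm] at h1
  have h2 : ‖h x - x‖ < 2 * ε := by
    calc ‖h x - x‖ = ‖(h x - g x) + ε • x‖ := by rw [hgx, add_smul, one_smul]; congr 1; abel
      _ ≤ ‖h x - g x‖ + ε * ‖x‖ := by
        refine (norm_add_le _ _).trans_eq ?_
        rw [norm_smul, Real.norm_of_nonneg hε.le]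
      _ < 2 * ε := by
        have : ‖x‖ ≤ 1 := by simpa using hx
        nlinarith
  have h3 : ‖h x₀ - x₀‖ ≤ ‖h x - x‖ := hmin hx
  linarith

/-! ### Brouwer's theorem for the simplex -/

/-- A retraction of `ι → ℝ` onto the standard simplex: take positive parts of the coordinates,
share a missing mass equally among them, and divide by the total mass. -/
noncomputable def stdSimplexRetraction {ι : Type*} [Fintype ι] (t : ι → ℝ) (i : ι) : ℝ :=
  (max (t i) 0 + max (1 - ∑ j, max (t j) 0) 0 / Fintype.card ι) / max (∑ j, max (t j) 0) 1

theorem continuous_stdSimplexRetraction {ι : Type*} [Fintype ι] :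
    Continuous (stdSimplexRetraction : (ι → ℝ) → ι → ℝ) := by
  refine continuous_pi fun i => Continuous.div (by fun_prop) (by fun_prop) fun t => ?_
  exact (zero_lt_one.trans_le (le_max_right _ _)).ne'

theorem stdSimplexRetraction_mem {ι : Type*} [Fintype ι] [Nonempty ι] (t : ι → ℝ) :
    stdSimplexRetraction t ∈ stdSimplex ℝ ι := by
  refine ⟨fun i => by unfold stdSimplexRetraction; positivity, ?_⟩
  simp only [stdSimplexRetraction]
  rw [← Finset.sum_div, Finset.sum_add_distrib, Finset.sum_const, Finset.card_univ,
    nsmul_eq_mul, mul_div_cancel₀ _ (by positivity : (Fintype.card ι : ℝ) ≠ 0)]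
  set s := ∑ j, max (t j) 0
  rcases le_total s 1 with h | h
  · rw [max_eq_left (by linarith), max_eq_right h]; ring
  · rw [max_eq_right (by linarith), max_eq_left h, add_zero, div_self (by linarith)]

theorem stdSimplexRetraction_eq_self {ι : Type*} [Fintype ι] {t : ι → ℝ}
    (ht : t ∈ stdSimplex ℝ ι) : stdSimplexRetraction t = t := by
  funext i
  have h : ∀ j, max (t j) 0 = t j := fun j => max_eq_left (ht.1 j)
  simp [stdSimplexRetraction, h, ht.2]

/-- **Brouwer's fixed point theorem** for the standard simplex. It lies in the Euclidean unit ball,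
so the retraction onto it reduces the claim to the ball. -/
theorem exists_fixedPoint_stdSimplex {ι : Type*} [Fintype ι] [Nonempty ι] {h : (ι → ℝ) → ι → ℝ}
    (hcont : ContinuousOn h (stdSimplex ℝ ι))
    (hmaps : Set.MapsTo h (stdSimplex ℝ ι) (stdSimplex ℝ ι)) :
    ∃ t ∈ stdSimplex ℝ ι, h t = t := by
  let H : EuclideanSpace ℝ ι → EuclideanSpace ℝ ι := fun z =>
    WithLp.toLp 2 (h (stdSimplexRetraction (WithLp.ofLp z)))
  have hmem : ∀ z : EuclideanSpace ℝ ι,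
      h (stdSimplexRetraction (WithLp.ofLp z)) ∈ stdSimplex ℝ ι := fun z =>
    hmaps (stdSimplexRetraction_mem _)
  have hH : Continuous H := by
    refine (PiLp.continuous_toLp 2 _).comp (hcont.comp_continuous ?_ fun z =>
      stdSimplexRetraction_mem _)
    exact continuous_stdSimplexRetraction.comp (PiLp.continuous_ofLp 2 _)
  have hball : ∀ z, ‖H z‖ ≤ 1 := by
    intro z
    rw [EuclideanSpace.norm_eq, Real.sqrt_le_one]
    calc ∑ i, ‖H z i‖ ^ 2 ≤ ∑ i, H z i := by
          refine Finset.sum_le_sum fun i _ => ?_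
          have h0 : 0 ≤ H z i := (hmem z).1 i
          have h1 : H z i ≤ 1 := (mem_Icc_of_mem_stdSimplex (hmem z) i).2
          rw [Real.norm_eq_abs, sq_abs]
          nlinarith
      _ = 1 := (hmem z).2
  obtain ⟨z, -, hz⟩ := exists_fixedPoint_of_continuous hH hball
  have hz' : h (stdSimplexRetraction (WithLp.ofLp z)) = WithLp.ofLp z :=
    congrArg WithLp.ofLp hz
  have hzmem : WithLp.ofLp z ∈ stdSimplex ℝ ι := hz' ▸ hmem z
  rw [stdSimplexRetraction_eq_self hzmem] at hz'
  exact ⟨_, hzmem, hz'⟩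

/-! ### Schauder's projection and compactness -/

/-- Schauder's projection argument: `f` has a fixed point up to `ε`, as measured by a continuous
convex function `p`. -/
theorem exists_convexOn_le_of_continuousOn {X : Type*} [AddCommGroup X] [Module ℝ X]
    [TopologicalSpace X] [IsTopologicalAddGroup X] [ContinuousSMul ℝ X] {C : Set X}
    (hne : C.Nonempty) (hcompact : IsCompact C) (hconvex : Convex ℝ C) {f : X → X}
    (hf : ContinuousOn f C) (hmaps : Set.MapsTo f C C) {p : X → ℝ} (hp : Continuous p)
    (hpconvex : ConvexOn ℝ Set.univ p) (hp0 : p 0 = 0) {ε : ℝ} (hε : 0 < ε) :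
    ∃ x ∈ C, p (f x - x) ≤ ε := by
  obtain ⟨T, hT, hcover⟩ := hcompact.elim_nhds_subcover (fun y => {z | p (z - y) < ε})
    fun y _ => (isOpen_lt (hp.comp (continuous_id.sub continuous_const)) continuous_const).mem_nhds
      (by simpa [hp0] using hε)
  have hTne : Nonempty T := by
    obtain ⟨y, hy⟩ := hne
    obtain ⟨i, hi, -⟩ := Set.mem_iUnion₂.1 (hcover hy)
    exact ⟨⟨i, hi⟩⟩
  let ψ : X → T → ℝ := fun z i => max (ε - p (z - i)) 0
  have hψ : Continuous ψ := by
    refine continuous_pi fun i => ?_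
    exact (continuous_const.sub (hp.comp (continuous_id.sub continuous_const))).max
      continuous_const
  have hψ0 : ∀ z i, 0 ≤ ψ z i := fun z i => le_max_right _ _
  have hψsum : ∀ z ∈ C, 0 < ∑ i, ψ z i := by
    intro z hz
    obtain ⟨i, hi, hzi⟩ := Set.mem_iUnion₂.1 (hcover hz)
    refine Finset.sum_pos' (fun i _ => hψ0 z i) ⟨⟨i, hi⟩, Finset.mem_univ _, ?_⟩
    exact lt_max_of_lt_left (sub_pos.2 hzi)
  let σ : (T → ℝ) → X := fun t => ∑ i, t i • (i : X)
  have hσ : Continuous σ :=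
    continuous_finsetSum _ fun i _ => (continuous_apply i).smul continuous_const
  have hσmem : Set.MapsTo σ (stdSimplex ℝ T) C := fun t ht =>
    hconvex.sum_mem (fun i _ => ht.1 i) ht.2 fun i _ => hT i i.2
  have hfσ : ContinuousOn (fun t => f (σ t)) (stdSimplex ℝ T) := hf.comp hσ.continuousOn hσmem
  have hfσmem : ∀ t ∈ stdSimplex ℝ T, f (σ t) ∈ C := fun t ht => hmaps (hσmem ht)
  obtain ⟨t, ht, hfix⟩ := exists_fixedPoint_stdSimplex
    (h := fun t i => ψ (f (σ t)) i / ∑ j, ψ (f (σ t)) j)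
    (by
      refine continuousOn_pi.2 fun i => ContinuousOn.div ?_ ?_ fun t ht =>
        (hψsum _ (hfσmem t ht)).ne'
      · exact ((continuous_apply i).comp hψ).comp_continuousOn hfσ
      · exact (continuous_finsetSum _ fun i _ =>
          (continuous_apply i).comp hψ).comp_continuousOn hfσ)
    (fun t ht => ⟨fun i => div_nonneg (hψ0 _ i) (hψsum _ (hfσmem t ht)).le, by
      rw [← Finset.sum_div, div_self (hψsum _ (hfσmem t ht)).ne']⟩)
  refine ⟨σ t, hσmem ht, ?_⟩
  set z := f (σ t)
  have hz : z - σ t = ∑ i, t i • (z - (i : X)) := by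
    simp only [smul_sub, Finset.sum_sub_distrib, ← Finset.sum_smul, ht.2, one_smul, σ]
  calc p (z - σ t) ≤ ∑ i, t i • p (z - (i : X)) := by
        rw [hz]
        exact hpconvex.map_sum_le (fun i _ => ht.1 i) ht.2 fun i _ => Set.mem_univ _
    _ ≤ ∑ i, t i * ε := by
        refine Finset.sum_le_sum fun i _ => ?_
        -- a vertex with `p (z - i) ≥ ε` has weight zero
        rcases lt_or_ge (p (z - (i : X))) ε with h | h
        · exact mul_le_mul_of_nonneg_left h.le (ht.1 i)
        · have h0 : t i = 0 := by
            rw [← hfix]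
            change max (ε - p (z - i)) 0 / _ = 0
            rw [max_eq_right (by linarith), zero_div]
          simp [h0]
    _ = ε := by rw [← Finset.sum_mul, ht.2, one_mul]

theorem exists_convexOn_eq_zero_of_continuousOn {X : Type*} [AddCommGroup X] [Module ℝ X]
    [TopologicalSpace X] [IsTopologicalAddGroup X] [ContinuousSMul ℝ X] {C : Set X}
    (hne : C.Nonempty) (hcompact : IsCompact C) (hconvex : Convex ℝ C) {f : X → X}
    (hf : ContinuousOn f C) (hmaps : Set.MapsTo f C C) {p : X → ℝ} (hp : Continuous p)
    (hpconvex : ConvexOn ℝ Set.univ p) (hp0 : p 0 = 0) (hpnonneg : ∀ x, 0 ≤ p x) :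
    ∃ x ∈ C, p (f x - x) = 0 := by
  obtain ⟨x, hx, hmin⟩ := hcompact.exists_isMinOn hne
    (hp.comp_continuousOn (hf.sub continuousOn_id))
  refine ⟨x, hx, le_antisymm (le_of_forall_pos_le_add fun ε hε => ?_) (hpnonneg _)⟩
  obtain ⟨y, hy, hpy⟩ :=
    exists_convexOn_le_of_continuousOn hne hcompact hconvex hf hmaps hp hpconvex hp0 hε
  rw [zero_add]
  exact (hmin hy).trans hpy

theorem exists_forall_convexOn_eq_zero_of_continuousOn {X : Type*} [AddCommGroup X] [Module ℝ X]
    [TopologicalSpace X] [IsTopologicalAddGroup X] [ContinuousSMul ℝ X] [T2Space X] {C : Set X}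
    (hne : C.Nonempty) (hcompact : IsCompact C) (hconvex : Convex ℝ C) {f : X → X}
    (hf : ContinuousOn f C) (hmaps : Set.MapsTo f C C) {ι : Type*} {p : ι → X → ℝ}
    (hp : ∀ i, Continuous (p i)) (hpconvex : ∀ i, ConvexOn ℝ Set.univ (p i))
    (hp0 : ∀ i, p i 0 = 0) (hpnonneg : ∀ i x, 0 ≤ p i x) :
    ∃ x ∈ C, ∀ i, p i (f x - x) = 0 := by
  have hclosed : ∀ i, IsClosed (C ∩ (fun x => p i (f x - x)) ⁻¹' {0}) := fun i =>
    ((hp i).comp_continuousOn (hf.sub continuousOn_id)).preimage_isClosed_of_isClosed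
      hcompact.isClosed isClosed_singleton
  obtain ⟨x, hx, hxi⟩ := hcompact.inter_iInter_nonempty _ hclosed fun u => by
    -- a common zero of finitely many `p i` is a zero of their sum
    obtain ⟨x, hx, hsum⟩ := exists_convexOn_eq_zero_of_continuousOn hne hcompact hconvex hf hmaps
      (p := fun x => ∑ i ∈ u, p i x) (continuous_finsetSum _ fun i _ => hp i)
      (by
        refine ⟨convex_univ, fun x _ y _ a b ha hb hab => ?_⟩
        simp only [Finset.smul_sum, ← Finset.sum_add_distrib]
        exact Finset.sum_le_sum fun i _ =>
          (hpconvex i).2 (Set.mem_univ x) (Set.mem_univ y) ha hb hab)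
      (Finset.sum_eq_zero fun i _ => hp0 i) fun x => Finset.sum_nonneg fun i _ => hpnonneg i x
    rw [Finset.sum_eq_zero_iff_of_nonneg fun i _ => hpnonneg i _] at hsum
    exact ⟨x, hx, Set.mem_iInter₂.2 fun i hi => ⟨hx, hsum i hi⟩⟩
  exact ⟨x, hx, fun i => (Set.mem_iInter.1 hxi i).2⟩

/-! ### Quasi-locally convex spaces -/

theorem theorem4p1 {X : Type*} [AddCommGroup X] [Module ℝ X] [TopologicalSpace X]
    [IsTopologicalAddGroup X] [ContinuousSMul ℝ X] [T2Space X]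
    {ι : Type*} (q : ι → X → ℝ≥0) (hq : IsQuasiLocallyConvexFamily q) (htot : IsTotalFamily q)
    (C : Set X) (hne : C.Nonempty) (hcompact : IsCompact C) (hconvex : Convex ℝ C)
    (f : C → C) (hf : Continuous f) :
    ∃ x : C, f x = x := by
  choose p φ hp hqp using hq.adjoint
  classical
  let g : X → X := fun x => if hx : x ∈ C then f ⟨x, hx⟩ else x
  have hg : ∀ x : C, g x = f x := fun x => dif_pos x.2
  have hgcont : ContinuousOn g C := by
    rw [continuousOn_iff_continuous_domRestrict]
    exact (continuous_subtype_val.comp hf).congr fun x => (hg x).symm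
  have hgmaps : Set.MapsTo g C C := fun x hx => by
    rw [hg ⟨x, hx⟩]; exact (f ⟨x, hx⟩).2
  obtain ⟨x, hx, hpx⟩ := exists_forall_convexOn_eq_zero_of_continuousOn hne hcompact hconvex
    hgcont hgmaps (p := fun i x => (p i x : ℝ))
    (fun i => NNReal.continuous_coe.comp (hp i)) (fun i => (hqp i).weaknorm.convexOn)
    (fun i => by rw [(hqp i).weaknorm.map_zero, NNReal.coe_zero]) fun i x => (p i x).coe_nonneg
  have hzero : g x - x = 0 := htot _ fun i => by
    have h := (hqp i).le (g x - x)
    rw [NNReal.coe_eq_zero.1 (hpx i), (hqp i).map_zero] at h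
    exact le_antisymm h zero_le
  refine ⟨⟨x, hx⟩, Subtype.ext ?_⟩
  rw [← hg ⟨x, hx⟩]
  exact sub_eq_zero.1 hzero
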